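/- Consider Maximum Independent Set in the vertex-arrival, vertex-adjacency model. An input item is a vertex name (from a fixed countably infinite set) together with the finite set of the names of its neighbours; an input $I$ is a finite set of $n=|I|$ items describing a simple graph (each vertex has at most one item, no vertex is its own neighbour, and if $u$ is listed as a neighbour of $v$, then $u$ has an item, which lists $v$). A fixed priority algorithm with advice is a deterministic algorithm that fixes an injective priority function $P$ from the set of all items to $\mathbb{R}$ in advance. An oracle that sees the whole input $I$ prepares an infinite tape of bits. The items of $I$ then arrive in order of decreasing priority, and the algorithm must irrevocably accept or reject each item on its arrival, depending only on the items seen so far, on $n$, and on the bits of the tape, read from left to right, that it has read so far. Let $\mathrm{ALG}(I)$ be the number of accepted vertices if they form an independent set and $0$ otherwise, and let $\mathrm{OPT}(I)$ be the maximum size of an independent set. The (asymptotic) approximation ratio of the algorithm is the infimum of all $c\in\mathbb{R}$ for which there is a constant $\alpha$ such that $\mathrm{OPT}(I)\le c\,\mathrm{ALG}(I)+\alpha$ for all inputs $I$ (and $+\infty$ if there is no such $c$). Let $H(\epsilon)=-\epsilon\log_2\epsilon-(1-\epsilon)\log_2(1-\epsilon)$ be the binary entropy function. Theorem. Let $\epsilon\in(0,\tfrac12]$.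 If a fixed priority algorithm with advice for Maximum Independent Set reads, for all sufficiently large $n$, fewer than $(1-H(\epsilon))n/16$ advice bits on every input with $n$ items, then its approximation ratio is at least $1+\frac{\epsilon}{3-\epsilon}$. -/

import Mathlib

namespace PriorityMIS

/-- An input item in the vertex arrival, vertex adjacency model: the name of a vertex together
with the finite set of the names of its neighbours. Names come from a countably infinite set. -/
abbrev Item : Type := ℕ × Finset ℕ

/-- The consistency condition: a finite set of items describes a finite simple graph, i.e. every
vertex name has at most one item, no vertex is its own neighbour, and if `u` is listed as a
neighbour of `v` then `u` has an item, and that item lists `v`. -/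
def Consistent (I : Finset Item) : Prop :=
  (∀ p ∈ I, ∀ q ∈ I, p.1 = q.1 → p = q) ∧
  (∀ p ∈ I, p.1 ∉ p.2) ∧
  (∀ p ∈ I, ∀ u ∈ p.2, ∃ q ∈ I, q.1 = u ∧ p.1 ∈ q.2)

/-- No vertex of `S` is listed as a neighbour of a vertex of `S`. -/
def Independent (S : Finset Item) : Prop :=
  ∀ p ∈ S, ∀ q ∈ S, q.1 ∉ p.2

instance (S : Finset Item) : Decidable (Independent S) := by
  unfold Independent; infer_instance

/-- The objective function, evaluated on the set of accepted items: the size of the set if it is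
independent, and `0` if the set is not a feasible solution. -/
def value (S : Finset Item) : ℕ := if Independent S then S.card else 0

/-- The optimal value: the size of a maximum independent set of the instance `I`. -/
def opt (I : Finset Item) : ℕ := I.powerset.sup value

/-- A deterministic fixed priority algorithm with advice, together with its oracle.

* `priority` is the priority function; it orders the universe totally, and items of larger
  priority arrive earlier.
* `advice I` is the infinite tape that the oracle prepares for the whole input `I`.
* `decide n seen x t` is the irrevocable decision (`true` is accept) on the arriving item `x`,
  when the input has `n` items in total, `seen` is the set of the items that arrived before `x`
  (their order is given by `priority`), and `t` is the advice tape.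
* `bitsRead n seen x t` is the length of the part of the tape that has been read when this
  decision is made. The tape is read from left to right, so `causal` says that the bits beyond
  this part have no influence. -/
structure Algorithm where
  priority : Item → ℝ
  priority_injective : Function.Injective priority
  advice : Finset Item → ℕ → Bool
  decide : ℕ → Finset Item → Item → (ℕ → Bool) → Bool
  bitsRead : ℕ → Finset Item → Item → (ℕ → Bool) → ℕ
  causal : ∀ (n : ℕ) (seen : Finset Item) (x : Item) (t t' : ℕ → Bool),
    (∀ i < bitsRead n seen x t, t i = t' i) →
      decide n seen x t' = decide n seen x t ∧ bitsRead n seen x t' = bitsRead n seen x t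

namespace Algorithm

/-- The items of the input `I` that arrive before `x`. -/
noncomputable def seenBefore (A : Algorithm) (I : Finset Item) (x : Item) : Finset Item :=
  I.filter fun y => A.priority x < A.priority y

/-- The set of items that `A` accepts on the input `I`. -/
noncomputable def accepted (A : Algorithm) (I : Finset Item) : Finset Item :=
  I.filter fun x => A.decide I.card (A.seenBefore I x) x (A.advice I) = true

/-- The number of advice bits that `A` reads on the input `I`. -/
noncomputable def adviceRead (A : Algorithm) (I : Finset Item) : ℕ :=
  I.sup fun x => A.bitsRead I.card (A.seenBefore I x) x (A.advice I)

/-- `A` is `c`-competitive: `OPT(I) ≤ c * ALG(I) + α` on all inputs, for some constant `α`. -/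
def IsCompetitive (A : Algorithm) (c : ℝ) : Prop :=
  ∃ α : ℝ, ∀ I : Finset Item, Consistent I →
    (opt I : ℝ) ≤ c * (value (A.accepted I) : ℝ) + α

/-- The (asymptotic) approximation ratio: the infimum of all `c` such that `A` is
`c`-competitive; it is `⊤` if there is no such `c`. -/
noncomputable def approximationRatio (A : Algorithm) : EReal :=
  ⨅ (c : ℝ) (_ : A.IsCompetitive c), (c : EReal)

end Algorithm

/-- The binary entropy function in bits, `H(p) = -p log₂ p - (1 - p) log₂ (1 - p)`. -/
noncomputable def H (p : ℝ) : ℝ := Real.binEntropy p / Real.log 2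

end PriorityMIS

namespace PriorityMIS

open Finset

/-! Each bit of a string is hidden in a block of nine names. As the graph is 4-regular, the item of
highest priority among all relabelled copies on a block can be made that of vertex `3`, which every
maximum independent set contains, or of vertex `1`, which none contains (`exists_top_item`).
Whatever arrives before it comes from blocks opened still earlier, so accepting or rejecting it is a
guess of a fresh bit, and a wrong guess costs one of the three vertices that the block can yield
(`value_add_errors_le`).

The advice read and the pattern of errors together determine the string
(`eq_of_prefix_eq_of_errors_eq`). By the entropy bound on Hamming balls, fewer than `(1 - H ε) m`
bits therefore leave more than `ε m` errors on some string of length `m`: at most `(3 - ε) m`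
vertices against an optimum of at least `3 m`. -/

/-! ### A 4-regular graph on nine vertices

Its independence number is three; the vertex `3` lies in every maximum independent set and the
vertex `1` lies in none. -/

/-- Row `u` lists the vertex `u` followed by its four neighbours. -/
def star : Fin 9 → Fin 5 → Fin 9 :=
  ![![0, 1, 2, 6, 8], ![1, 0, 3, 6, 8], ![2, 0, 4, 5, 7], ![3, 1, 5, 7, 8], ![4, 2, 5, 6, 7],
    ![5, 2, 3, 4, 7], ![6, 0, 1, 4, 8], ![7, 2, 3, 4, 5], ![8, 0, 1, 3, 6]]

/-- The neighbours of a vertex. -/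
def nbr (u : Fin 9) : Finset (Fin 9) := univ.image fun j : Fin 4 => star u j.succ

lemma star_zero : ∀ u, star u 0 = u := by decide

lemma star_injective : ∀ u, Function.Injective (star u) := by decide

lemma notMem_nbr_self : ∀ u, u ∉ nbr u := by decide

lemma mem_nbr_comm : ∀ u v, v ∈ nbr u → u ∈ nbr v := by decide

lemma eq_three_of_triple : ∀ a b c : Fin 9, a ≠ b → a ≠ c → b ≠ c →
    b ∉ nbr a → c ∉ nbr a → c ∉ nbr b → a = 3 ∨ b = 3 ∨ c = 3 := by decide

/-- The four non-neighbours `2, 4, 5, 7` of `1` form a clique, so an independent set through `1` has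
room for only one of them. -/
lemma eq_or_mem_nbr_of_one : ∀ a b : Fin 9, a ≠ 1 → b ≠ 1 → a ≠ b →
    a ∉ nbr 1 → b ∉ nbr 1 → b ∈ nbr a := by decide

lemma card_le_two_of_three_notMem {T : Finset (Fin 9)} (hT : ∀ u ∈ T, ∀ v ∈ T, v ∉ nbr u)
    (h : 3 ∉ T) : T.card ≤ 2 := by
  by_contra! hc
  obtain ⟨a, b, c, ha, hb, hc, hab, hac, hbc⟩ := two_lt_card_iff.1 hc
  rcases eq_three_of_triple a b c hab hac hbc (hT a ha b hb) (hT a ha c hc) (hT b hb c hc)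
    with rfl | rfl | rfl <;> exact h ‹_›

lemma card_le_two_of_one_mem {T : Finset (Fin 9)} (hT : ∀ u ∈ T, ∀ v ∈ T, v ∉ nbr u)
    (h : 1 ∈ T) : T.card ≤ 2 := by
  by_contra! hc
  have h2 : 1 < (T.erase 1).card := by rw [card_erase_of_mem h]; omega
  obtain ⟨a, ha, b, hb, hab⟩ := one_lt_card.1 h2
  rw [mem_erase] at ha hb
  exact hT a ha.2 b hb.2 (eq_or_mem_nbr_of_one a b ha.1 hb.1 hab (hT 1 h a ha.2) (hT 1 h b hb.2))

lemma card_le_three {T : Finset (Fin 9)} (hT : ∀ u ∈ T, ∀ v ∈ T, v ∉ nbr u) : T.card ≤ 3 := by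
  have h := card_le_two_of_three_notMem (T := T.erase 3)
    (fun u hu v hv => hT u (mem_of_mem_erase hu) v (mem_of_mem_erase hv)) (notMem_erase 3 T)
  have := pred_card_le_card_erase (s := T) (a := 3)
  omega

/-- Any two closed neighbourhoods are matched by a permutation of the vertices. -/
lemma exists_perm_star (u v : Fin 9) : ∃ τ : Equiv.Perm (Fin 9), ∀ j, τ (star u j) = star v j := by
  -- All closed neighbourhoods have five elements, and the symmetric group is 5-transitive.
  have := Equiv.Perm.isMultiplyPretransitive (Fin 9) 5
  obtain ⟨τ, hτ⟩ := MulAction.exists_smul_eq (Equiv.Perm (Fin 9))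
    (⟨star u, star_injective u⟩ : Fin 5 ↪ Fin 9) ⟨star v, star_injective v⟩
  exact ⟨τ, fun j => DFunLike.congr_fun hτ j⟩

/-! ### Instances made of relabelled copies of the graph -/

/-- The name of the vertex `v` of the block `i`. -/
def vertexName (i : ℕ) (v : Fin 9) : ℕ := 9 * i + v

lemma vertexName_inj {i j : ℕ} {u v : Fin 9} :
    vertexName i u = vertexName j v ↔ i = j ∧ u = v := by
  unfold vertexName
  have := u.isLt
  have := v.isLt
  rw [Fin.ext_iff]
  omega

/-- The item of the vertex `u` in the copy on block `i`, relabelled by `σ`. -/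
def blockItem (i : ℕ) (σ : Equiv.Perm (Fin 9)) (u : Fin 9) : Item :=
  (vertexName i (σ u), (nbr u).image fun v => vertexName i (σ v))

lemma mem_blockItem_snd {i j : ℕ} {σ τ : Equiv.Perm (Fin 9)} {u v : Fin 9} :
    (blockItem j τ v).1 ∈ (blockItem i σ u).2 ↔ i = j ∧ ∃ w ∈ nbr u, σ w = τ v := by
  simp only [blockItem, mem_image, vertexName_inj]
  grind

/-- An item reveals the labels of one closed neighbourhood and nothing else, so different vertices
in different copies can share an item. -/
lemma blockItem_congr {i : ℕ} {σ τ : Equiv.Perm (Fin 9)} {u v : Fin 9}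
    (h : ∀ j, σ (star u j) = τ (star v j)) : blockItem i σ u = blockItem i τ v := by
  have h0 := h 0
  rw [star_zero, star_zero] at h0
  simp only [blockItem, h0, nbr, image_image, Function.comp_def, h]

variable {m : ℕ}

/-- The disjoint union of `m` copies of the graph, the one on block `i` relabelled by `σ i`. -/
def instanceOf (σ : Fin m → Equiv.Perm (Fin 9)) : Finset Item :=
  univ.image fun p : Fin m × Fin 9 => blockItem p.1 (σ p.1) p.2

lemma blockItem_injective (σ : Fin m → Equiv.Perm (Fin 9)) :
    Function.Injective fun p : Fin m × Fin 9 => blockItem p.1 (σ p.1) p.2 := by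
  rintro ⟨i, u⟩ ⟨j, v⟩ h
  obtain ⟨h1, h2⟩ := vertexName_inj.1 (congrArg Prod.fst h)
  obtain rfl := Fin.ext h1
  simpa using h2

lemma mem_instanceOf {σ : Fin m → Equiv.Perm (Fin 9)} {x : Item} :
    x ∈ instanceOf σ ↔ ∃ (i : Fin m) (u : Fin 9), blockItem i (σ i) u = x := by
  simp [instanceOf]

lemma card_instanceOf (σ : Fin m → Equiv.Perm (Fin 9)) : (instanceOf σ).card = 9 * m := by
  rw [instanceOf, card_image_of_injective _ (blockItem_injective σ)]
  simp [mul_comm]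

lemma consistent_instanceOf (σ : Fin m → Equiv.Perm (Fin 9)) : Consistent (instanceOf σ) := by
  refine ⟨?_, ?_, ?_⟩
  · intro p hp q hq h
    obtain ⟨i, u, rfl⟩ := mem_instanceOf.1 hp
    obtain ⟨j, v, rfl⟩ := mem_instanceOf.1 hq
    obtain ⟨h1, h2⟩ := vertexName_inj.1 h
    obtain rfl := Fin.ext h1
    rw [(σ i).injective h2]
  · intro p hp
    obtain ⟨i, u, rfl⟩ := mem_instanceOf.1 hp
    rw [mem_blockItem_snd]
    rintro ⟨-, w, hw, h⟩
    exact notMem_nbr_self u ((σ i).injective h ▸ hw)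
  · intro p hp x hx
    obtain ⟨i, u, rfl⟩ := mem_instanceOf.1 hp
    obtain ⟨v, hv, rfl⟩ := mem_image.1 hx
    exact ⟨_, mem_instanceOf.2 ⟨i, v, rfl⟩, rfl,
      mem_blockItem_snd.2 ⟨rfl, u, mem_nbr_comm u v hv, rfl⟩⟩

lemma le_opt_instanceOf (σ : Fin m → Equiv.Perm (Fin 9)) : 3 * m ≤ opt (instanceOf σ) := by
  set S : Finset Item := ((univ : Finset (Fin m)) ×ˢ ({0, 3, 4} : Finset (Fin 9))).image
    fun p => blockItem p.1 (σ p.1) p.2 with hS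
  have hcard : S.card = 3 * m := by
    rw [hS, card_image_of_injective _ (blockItem_injective σ), card_product]
    simp [mul_comm]
  have hind : Independent S := by
    intro p hp q hq
    obtain ⟨⟨i, u⟩, hu, rfl⟩ := mem_image.1 hp
    obtain ⟨⟨j, v⟩, hv, rfl⟩ := mem_image.1 hq
    rw [mem_blockItem_snd]
    rintro ⟨h1, w, hw, h2⟩
    obtain rfl := Fin.ext h1
    have hwv : w = v := (σ i).injective h2
    have key : ∀ u ∈ ({0, 3, 4} : Finset (Fin 9)), ∀ v ∈ ({0, 3, 4} : Finset (Fin 9)),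
      v ∉ nbr u := by decide
    exact key u (mem_product.1 hu).2 v (mem_product.1 hv).2 (hwv ▸ hw)
  have hsub : S ∈ (instanceOf σ).powerset :=
    mem_powerset.2 (image_subset_image (subset_univ _))
  have := le_sup (f := value) hsub
  rwa [value, if_pos hind, hcard] at this

/-- A set of items of the instance loses one vertex on every block where it takes the vertex `1`
or omits the vertex `3`. -/
lemma value_add_card_le (σ : Fin m → Equiv.Perm (Fin 9)) {S : Finset Item}
    (hS : S ⊆ instanceOf σ) (E : Finset (Fin m))
    (hE : ∀ i ∈ E, blockItem i (σ i) 1 ∈ S ∨ blockItem i (σ i) 3 ∉ S) :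
    value S + E.card ≤ 3 * m := by
  unfold value
  split_ifs with hind
  -- The trace of `S` on each block, pulled back to the unlabelled graph.
  · let T : Fin m → Finset (Fin 9) := fun i => univ.filter fun u => blockItem i (σ i) u ∈ S
    have hT : ∀ i, ∀ u ∈ T i, ∀ v ∈ T i, v ∉ nbr u := by
      intro i u hu v hv huv
      exact hind _ (mem_filter.1 hu).2 _ (mem_filter.1 hv).2
        (mem_blockItem_snd.2 ⟨rfl, v, huv, rfl⟩)
    have hST : S ⊆ (univ.sigma T).image fun p : (_ : Fin m) × Fin 9 => blockItem p.1 (σ p.1) p.2 := by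
      intro x hx
      obtain ⟨i, u, rfl⟩ := mem_instanceOf.1 (hS hx)
      exact mem_image.2 ⟨⟨i, u⟩, by simpa [T] using hx, rfl⟩
    have h1 : S.card ≤ ∑ i, (T i).card := by
      rw [← card_sigma]
      exact (card_le_card hST).trans card_image_le
    have h2 : ∀ i, (T i).card + (if i ∈ E then 1 else 0) ≤ 3 := by
      intro i
      split_ifs with hi
      · have : (T i).card ≤ 2 := by
          rcases hE i hi with h | h
          · exact card_le_two_of_one_mem (hT i) (by simpa [T] using h)
          · exact card_le_two_of_three_notMem (hT i) (by simpa [T] using h)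
        omega
      · exact card_le_three (hT i)
    have h3 := sum_le_sum fun i (_ : i ∈ (univ : Finset (Fin m))) => h2 i
    rw [sum_add_distrib] at h3
    simp at h3
    omega
  · have := card_le_univ E
    rw [Fintype.card_fin] at this
    omega

/-! ### The number of strings of small weight -/

/-- The entropy bound on the volume of a Hamming ball. -/
lemma card_weight_le (m : ℕ) {ε : ℝ} (h0 : 0 < ε) (h1 : ε ≤ 1 / 2) :
    ((univ.filter fun f : Fin m → Bool =>
      ((univ.filter fun i => f i = true).card : ℝ) ≤ ε * m).card : ℝ) ≤ 2 ^ (H ε * m) := by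
  have h1' : 0 < 1 - ε := by linarith
  set B := univ.filter fun f : Fin m → Bool =>
      ((univ.filter fun i => f i = true).card : ℝ) ≤ ε * m with hB
  have hexp : (2 : ℝ) ^ (H ε * m) = Real.exp (m * Real.binEntropy ε) := by
    rw [Real.rpow_def_of_pos two_pos, H]
    congr 1
    have := Real.log_pos one_lt_two
    field_simp
  -- The probability of `f` when its bits are independent and `true` with probability `ε`.
  let w : (Fin m → Bool) → ℝ := fun f => ∏ i, if f i = true then ε else 1 - ε
  have hsum : ∑ f, w f = 1 := by
    have := (Finset.prod_univ_sum (fun _ : Fin m => (univ : Finset Bool))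
      (fun _ b => if b = true then ε else 1 - ε)).symm
    rw [Fintype.piFinset_univ] at this
    simpa [w] using this
  have hw : ∀ f ∈ B, Real.exp (-(m * Real.binEntropy ε)) ≤ w f := by
    intro f hf
    have hf' := (mem_filter.1 hf).2
    set e := (univ.filter fun i => f i = true).card with he
    have hcard : (e : ℝ) + (univ.filter fun i => ¬ f i = true).card = m := by
      have := card_filter_add_card_filter_not (s := (univ : Finset (Fin m))) (fun i => f i = true)
      rw [card_univ, Fintype.card_fin] at this
      exact_mod_cast this
    have hwf : w f = Real.exp (e * Real.log ε + (m - e) * Real.log (1 - ε)) := by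
      simp only [w]
      rw [prod_ite, prod_const, prod_const, ← he, Real.exp_add, ← hcard, add_sub_cancel_left,
        mul_comm (e : ℝ), mul_comm (_ : ℝ) (Real.log (1 - ε)), Real.exp_mul, Real.exp_mul,
        Real.exp_log h0, Real.exp_log h1', Real.rpow_natCast, Real.rpow_natCast]
    rw [hwf, Real.exp_le_exp, Real.binEntropy_eq_negMulLog_add_negMulLog_one_sub, Real.negMulLog,
      Real.negMulLog]
    -- As `ε ≤ 1 / 2`, `w f` decreases with the weight `e`, so on the ball it is at least its value
    -- at `e = ε m`.
    have hlog : Real.log ε ≤ Real.log (1 - ε) := Real.log_le_log h0 (by linarith)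
    nlinarith
  have : (B.card : ℝ) * Real.exp (-(m * Real.binEntropy ε)) ≤ 1 := by
    calc _ = ∑ f ∈ B, Real.exp (-(m * Real.binEntropy ε)) := by simp
      _ ≤ ∑ f ∈ B, w f := sum_le_sum hw
      _ ≤ ∑ f, w f := sum_le_sum_of_subset_of_nonneg (subset_univ _) fun f _ _ =>
          prod_nonneg fun i _ => by split_ifs <;> linarith
      _ = 1 := hsum
  rw [hexp]
  rw [Real.exp_neg] at this
  rwa [← div_eq_mul_inv, div_le_one (Real.exp_pos _)] at this

/-! ### The adversary -/

namespace Algorithm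

variable (A : Algorithm)

/-- In every block some item has the largest priority among all items of all relabelled copies;
it can be made the item of any vertex. -/
lemma exists_top_item (i : ℕ) : ∃ (x : Item) (σ : Bool → Equiv.Perm (Fin 9)),
    blockItem i (σ true) 3 = x ∧ blockItem i (σ false) 1 = x ∧
      ∀ τ u, A.priority (blockItem i τ u) ≤ A.priority x := by
  obtain ⟨⟨ρ, v⟩, hmax⟩ := Finite.exists_max
    fun p : Equiv.Perm (Fin 9) × Fin 9 => A.priority (blockItem i p.1 p.2)
  obtain ⟨τ₁, h₁⟩ := exists_perm_star 3 v
  obtain ⟨τ₂, h₂⟩ := exists_perm_star 1 v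
  refine ⟨blockItem i ρ v, fun b => if b then τ₁.trans ρ else τ₂.trans ρ, ?_, ?_, ?_⟩
  · exact blockItem_congr fun j => by simp [h₁]
  · exact blockItem_congr fun j => by simp [h₂]
  · exact fun τ u => hmax (τ, u)

/-- An item that arrives first in its block. -/
noncomputable def topItem (i : ℕ) : Item := (A.exists_top_item i).choose

/-- The relabelling that makes the first item of the block that of the vertex `3` (for `true`)
or `1` (for `false`). -/
noncomputable def relabel (i : ℕ) : Bool → Equiv.Perm (Fin 9) :=
  (A.exists_top_item i).choose_spec.choose

lemma blockItem_relabel_true (i : ℕ) : blockItem i (A.relabel i true) 3 = A.topItem i :=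
  (A.exists_top_item i).choose_spec.choose_spec.1

lemma blockItem_relabel_false (i : ℕ) : blockItem i (A.relabel i false) 1 = A.topItem i :=
  (A.exists_top_item i).choose_spec.choose_spec.2.1

lemma priority_le_topItem (i : ℕ) (τ : Equiv.Perm (Fin 9)) (u : Fin 9) :
    A.priority (blockItem i τ u) ≤ A.priority (A.topItem i) :=
  (A.exists_top_item i).choose_spec.choose_spec.2.2 τ u

/-- The instance that encodes the string `b`. -/
noncomputable def encode (b : Fin m → Bool) : Finset Item :=
  instanceOf fun i => A.relabel i (b i)

lemma topItem_mem_encode (b : Fin m → Bool) (i : Fin m) : A.topItem i ∈ A.encode b := by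
  rw [encode, mem_instanceOf]
  cases hb : b i
  · exact ⟨i, 1, by rw [hb, A.blockItem_relabel_false]⟩
  · exact ⟨i, 3, by rw [hb, A.blockItem_relabel_true]⟩

/-- The decision on the first item of the block `i`, on the instance that encodes `b`. -/
noncomputable def guess (b : Fin m → Bool) (i : Fin m) : Bool :=
  A.decide (A.encode b).card (A.seenBefore (A.encode b) (A.topItem i)) (A.topItem i)
    (A.advice (A.encode b))

lemma topItem_mem_accepted (b : Fin m → Bool) (i : Fin m) :
    A.topItem i ∈ A.accepted (A.encode b) ↔ A.guess b i = true := by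
  simp [accepted, guess, A.topItem_mem_encode b i]

/-- Every wrong guess costs one vertex. -/
lemma value_add_errors_le (b : Fin m → Bool) :
    value (A.accepted (A.encode b)) + (univ.filter fun i => (A.guess b i ^^ b i) = true).card
      ≤ 3 * m := by
  refine value_add_card_le (fun i => A.relabel i (b i)) (S := A.accepted (A.encode b))
    (filter_subset _ _) _ fun i hi => ?_
  have hi := (mem_filter.1 hi).2
  cases hb : b i
  · left
    rw [A.blockItem_relabel_false, A.topItem_mem_accepted]
    simpa [hb] using hi
  · right
    rw [A.blockItem_relabel_true, A.topItem_mem_accepted]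
    simpa [hb] using hi

/-- An item that precedes the top item of block `i` lies in a block whose own top item also precedes
it, and there the two strings agree. -/
lemma seenBefore_subset {b b' : Fin m → Bool} {i : Fin m}
    (h : ∀ j : Fin m, A.priority (A.topItem i) < A.priority (A.topItem j) → b j = b' j) :
    A.seenBefore (A.encode b) (A.topItem i) ⊆ A.seenBefore (A.encode b') (A.topItem i) := by
  intro y hy
  obtain ⟨hy, hlt⟩ := mem_filter.1 hy
  obtain ⟨j, u, rfl⟩ := mem_instanceOf.1 hy
  refine mem_filter.2 ⟨mem_instanceOf.2 ⟨j, u, ?_⟩, hlt⟩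
  rw [h j (hlt.trans_le (A.priority_le_topItem _ _ _))]

lemma bitsRead_le_adviceRead {I : Finset Item} {x : Item} (hx : x ∈ I) :
    A.bitsRead I.card (A.seenBefore I x) x (A.advice I) ≤ A.adviceRead I :=
  le_sup (f := fun x => A.bitsRead I.card (A.seenBefore I x) x (A.advice I)) hx

/-- The advice that is read and the pattern of wrong guesses determine the string. -/
lemma eq_of_prefix_eq_of_errors_eq {k : ℕ} (hk : ∀ b : Fin m → Bool, A.adviceRead (A.encode b) ≤ k)
    {b b' : Fin m → Bool}
    (hadv : ∀ l < k, A.advice (A.encode b) l = A.advice (A.encode b') l)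
    (herr : ∀ i, (A.guess b i ^^ b i) = (A.guess b' i ^^ b' i)) : b = b' := by
  by_contra hne
  have hD : (univ.filter fun i => b i ≠ b' i).Nonempty := by
    obtain ⟨i, hi⟩ := Function.ne_iff.1 hne
    exact ⟨i, by simpa using hi⟩
  -- Among the blocks where the strings differ, `i` is the one whose top item arrives first; up to
  -- then both runs look the same.
  obtain ⟨i, hi, hmax⟩ := exists_max_image _ (fun i : Fin m => A.priority (A.topItem i)) hD
  have hagree : ∀ j : Fin m, A.priority (A.topItem i) < A.priority (A.topItem j) → b j = b' j := by
    intro j hj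
    by_contra h
    exact (hmax j (by simpa using h)).not_gt hj
  have hseen : A.seenBefore (A.encode b') (A.topItem i) = A.seenBefore (A.encode b) (A.topItem i) :=
    (A.seenBefore_subset fun j hj => (hagree j hj).symm).antisymm (A.seenBefore_subset hagree)
  have hcard : (A.encode b').card = (A.encode b).card := by
    rw [encode, encode, card_instanceOf, card_instanceOf]
  have hg : A.guess b' i = A.guess b i := by
    rw [guess, guess, hseen, hcard]
    refine (A.causal _ _ _ _ _ fun l hl => hadv l ?_).1
    exact hl.trans_le ((A.bitsRead_le_adviceRead (A.topItem_mem_encode b i)).trans (hk b))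
  have h := herr i
  rw [hg] at h
  exact (mem_filter.1 hi).2 (by simpa using h)

/-- If few advice bits are read, then some string is guessed badly. -/
lemma exists_many_errors {ε : ℝ} (h0 : 0 < ε) (h1 : ε ≤ 1 / 2)
    (h : ∀ b : Fin m → Bool, (A.adviceRead (A.encode b) : ℝ) < (1 - H ε) * m) :
    ∃ b : Fin m → Bool, ε * m < (univ.filter fun i => (A.guess b i ^^ b i) = true).card := by
  by_contra! hcon
  -- The largest number of bits read gives one prefix length `k` for all strings.
  obtain ⟨b₀, hmax⟩ := Finite.exists_max fun b : Fin m → Bool => A.adviceRead (A.encode b)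
  have hlt := h b₀
  generalize A.adviceRead (A.encode b₀) = k at hmax hlt
  have hball := card_weight_le m h0 h1
  generalize hB : (univ.filter fun f : Fin m → Bool =>
    ((univ.filter fun i => f i = true).card : ℝ) ≤ ε * m) = B at hball
  have hmem : ∀ b : Fin m → Bool, (fun i => (A.guess b i ^^ b i)) ∈ B := fun b => by
    rw [← hB]
    exact mem_filter.2 ⟨mem_univ _, hcon b⟩
  have hinj : Set.InjOn (fun b : Fin m → Bool =>
      ((fun l : Fin k => A.advice (A.encode b) l), fun i => (A.guess b i ^^ b i)))
      (univ : Finset (Fin m → Bool)) := by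
    intro b _ b' _ hbb
    rw [Prod.mk.injEq] at hbb
    exact A.eq_of_prefix_eq_of_errors_eq hmax
      (fun l hl => congrFun hbb.1 ⟨l, hl⟩) fun i => congrFun hbb.2 i
  have hle := card_le_card_of_injOn (t := (univ : Finset (Fin k → Bool)) ×ˢ B) _
    (fun b _ => mem_coe.2 (mem_product.2 ⟨mem_univ _, hmem b⟩)) hinj
  rw [card_product] at hle
  simp only [card_univ, Fintype.card_fun, Fintype.card_bool, Fintype.card_fin] at hle
  have hle' : (2 : ℝ) ^ (m : ℝ) ≤ 2 ^ ((k : ℝ) + H ε * m) := by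
    rw [Real.rpow_add two_pos, Real.rpow_natCast, Real.rpow_natCast]
    calc (2 : ℝ) ^ m ≤ 2 ^ k * B.card := by exact_mod_cast hle
      _ ≤ _ := by gcongr
  have := (Real.rpow_le_rpow_left_iff one_lt_two).1 hle'
  linarith

end Algorithm

/-! ### From wrong guesses to the approximation ratio -/

lemma H_le_one (p : ℝ) : H p ≤ 1 := by
  rw [H, div_le_one (Real.log_pos one_lt_two)]
  exact Real.binEntropy_le_log_two

end PriorityMIS

theorem mainTheorem5 (ε : ℝ) (hε_pos : 0 < ε) (hε_le : ε ≤ 1 / 2)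
    (A : PriorityMIS.Algorithm)
    (hA : ∀ᶠ n : ℕ in Filter.atTop, ∀ I : Finset PriorityMIS.Item,
      PriorityMIS.Consistent I → I.card = n →
        (A.adviceRead I : ℝ) < (1 - PriorityMIS.H ε) * (n : ℝ) / 16) :
    ((1 + ε / (3 - ε) : ℝ) : EReal) ≤ A.approximationRatio := by
  refine le_iInf₂ fun c hc => EReal.coe_le_coe_iff.2 ?_
  obtain ⟨α, hα⟩ := hc
  obtain ⟨N, hN⟩ := Filter.eventually_atTop.1 hA
  have h3 : 0 < 3 - ε := by linarith
  -- Nothing excludes a negative `c` beforehand; `max c 0` lets the upper bound on the value be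
  -- multiplied through.
  have key : ∀ m : ℕ, N ≤ m → 3 * (m : ℝ) ≤ max c 0 * ((3 - ε) * m) + α := by
    intro m hm
    obtain ⟨b, hb⟩ := A.exists_many_errors (m := m) hε_pos hε_le fun b => by
      have h := hN (9 * m) (by omega) (A.encode b) (PriorityMIS.consistent_instanceOf _)
        (PriorityMIS.card_instanceOf _)
      -- With `n = 9 m`, the allowance `(1 - H ε) n / 16` is at most `(1 - H ε) m`, since `9 / 16 ≤
      -- 1` and `H ε ≤ 1`.
      have := mul_nonneg (sub_nonneg.2 (PriorityMIS.H_le_one ε)) (Nat.cast_nonneg (α := ℝ) m)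
      push_cast at h
      linarith
    have hopt : (3 * m : ℝ) ≤ PriorityMIS.opt (A.encode b) := by
      exact_mod_cast PriorityMIS.le_opt_instanceOf _
    have hval : (PriorityMIS.value (A.accepted (A.encode b)) : ℝ) ≤ (3 - ε) * m := by
      have h : (_ : ℝ) ≤ _ := Nat.cast_le.2 (A.value_add_errors_le b)
      push_cast at h
      linarith
    calc 3 * (m : ℝ) ≤ c * PriorityMIS.value (A.accepted (A.encode b)) + α :=
          hopt.trans (hα _ (PriorityMIS.consistent_instanceOf _))
      _ ≤ max c 0 * PriorityMIS.value (A.accepted (A.encode b)) + α := by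
          gcongr; exact le_max_left _ _
      _ ≤ _ := by gcongr
  by_contra! hlt
  have hpos : 0 < 1 + ε / (3 - ε) := by positivity
  have hgap : 0 < 3 - max c 0 * (3 - ε) := by
    have h := mul_lt_mul_of_pos_right (max_lt hlt hpos) h3
    have h' : (1 + ε / (3 - ε)) * (3 - ε) = 3 := by field_simp; ring
    linarith
  -- Beyond this threshold the linear gap exceeds the additive constant `α`.
  obtain ⟨m, hm⟩ := exists_nat_gt (α / (3 - max c 0 * (3 - ε)))
  rw [div_lt_iff₀ hgap] at hm
  have h := key (max N m) (le_max_left _ _)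
  have hmm : (m : ℝ) ≤ (max N m : ℕ) := by exact_mod_cast le_max_right N m
  have := mul_le_mul_of_nonneg_right hmm hgap.le
  linarith
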